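/- There is an absolute constant $\mu_0>0$ such that for every $c>0$ there are constants $C,c_1,c_2>0$, depending only on $c$, with the following property. Let $0<\mu\le\mu_0$, let $N\ge 1$ be an integer, let $A\subseteq\mathbb{Z}/N\mathbb{Z}$ be a nonempty set of density $\delta=|A|/N$ with $\delta^{\mu/20}\log(1/\delta)<1$, and for real $\theta$ put $$\Delta_\theta=\Big\{r\in\mathbb{Z}/N\mathbb{Z}:\ \Big|\sum_{x\in A}e^{-2\pi i xr/N}\Big|\ge\theta|A|\Big\}.$$ Suppose that $|\Delta_\theta|\ge c\,\theta^{-3}\delta^{\mu/4}$ for some $\theta$ with $\delta^{1-\mu}\le\theta\le\delta^{1/10}$. Then there are a set $\Gamma\subseteq\mathbb{Z}/N\mathbb{Z}$ of size $|\Gamma|\le C\delta^{-1+\mu/3}$, a radius $\gamma\in(0,\tfrac12]$ with $\gamma\ge c_1\delta^{1-\mu/3}$, and $t\in\mathbb{Z}/N\mathbb{Z}$ such that the Bohr set $B=B(\Gamma,\gamma)$ is regular and $$|(A+t)\cap B|\ge c_2\,\delta^{1-\mu/4}|B|.$$ Here $B(\Gamma,\gamma)=\{x\in\mathbb{Z}/N\mathbb{Z}:\|sx/N\|\le\gamma\text{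 for all }s\in\Gamma\}$, where $\|\cdot\|$ is the distance to the nearest integer; $|\Gamma|$ is the rank of this Bohr set; and $B(\Gamma,\gamma)$ is called regular if for every real $\eta$ with $100|\Gamma||\eta|\le 1$ $$(1-100|\Gamma||\eta|)\,|B(\Gamma,\gamma)|\le|B(\Gamma,(1+\eta)\gamma)|\le(1+100|\Gamma||\eta|)\,|B(\Gamma,\gamma)|.$$ -/

import Mathlib

noncomputable section

open scoped ZMod

/-- The Fourier coefficient `∑ x ∈ A, e(-x r / N)` of the indicator function of `A`. -/
def indicatorFourier {N : ℕ} [NeZero N] (A : Finset (ZMod N)) (r : ZMod N) : ℂ :=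
  𝓕 (fun x : ZMod N => if x ∈ A then (1 : ℂ) else 0) r

open scoped Classical in
/-- The `θ`-spectrum: all `r` at which the Fourier coefficient of the indicator function of `A`
has absolute value at least `θ |A|`. -/
def largeSpectrum {N : ℕ} [NeZero N] (A : Finset (ZMod N)) (θ : ℝ) : Finset (ZMod N) :=
  Finset.univ.filter fun r => θ * (A.card : ℝ) ≤ ‖indicatorFourier A r‖

open scoped Classical in
/-- The Bohr set with generating set `Γ` and radius `γ`. The norm on `UnitAddCircle = ℝ / ℤ` is
the distance to the nearest integer, and `ZMod.toAddCircle` sends `j` to `j / N` modulo `1`. -/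
def bohrSet {N : ℕ} [NeZero N] (Γ : Finset (ZMod N)) (γ : ℝ) : Finset (ZMod N) :=
  Finset.univ.filter fun x => ∀ t ∈ Γ, ‖ZMod.toAddCircle (t * x)‖ ≤ γ

/-- Regularity of the Bohr set with generating set `Γ` (of size `Γ.card`, the rank) and
radius `γ`. The condition `|η| ≤ 1 / (100 |Γ|)` is written without division. -/
def IsRegularBohr {N : ℕ} [NeZero N] (Γ : Finset (ZMod N)) (γ : ℝ) : Prop :=
  ∀ η : ℝ, 100 * (Γ.card : ℝ) * |η| ≤ 1 →
    (1 - 100 * (Γ.card : ℝ) * |η|) * ((bohrSet Γ γ).card : ℝ)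
        ≤ ((bohrSet Γ ((1 + η) * γ)).card : ℝ) ∧
      ((bohrSet Γ ((1 + η) * γ)).card : ℝ)
        ≤ (1 + 100 * (Γ.card : ℝ) * |η|) * ((bohrSet Γ γ).card : ℝ)

end

/-! ### Frequencies controlled by a small set -/

noncomputable section

open scoped ZMod ComplexConjugate

/-! Duality drives the proof. For `X` inside the spectrum, let `H y` be the sum over `r ∈ X` of `1 +
Re (c r e(ry/N))`, with phases `c r` aligned to the Fourier coefficients of `A`. The mean of `H` on
`A` is at least `(1 + θ)|X|`, so by Jensen its `K`-th moment is at least `|A| ((1 + θ)|X|) ^ K`. If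
no `Γ` with at most `K` elements dominated more than a proportion `θ/2` of `X`, expanding the moment
as Riesz products would bound it by `N ((1 + θ/2)|X|) ^ K`. For `K` slightly above `4 log(1/δ)/θ`
these conflict, so such a `Γ` exists (`exists_card_bohrDominated_gt`).

Repeating this about `δ^(-μ/2)` times gives a set `D` of spectral frequencies with `|D| θ² ≥ (c/4)
δ^(-μ/4)`, all dominated by at most `mK` frequencies. On a Bohr set of radius at most `1/(6K)` every
character in `D` has real part at least `1/2`, and Parseval turns this into a density gain of order
`|D| θ²` on a translate (`exists_card_image_add_inter_ge`). A Vitali covering argument supplies a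
regular radius (`exists_isRegularBohr`). -/

/-- A frequency `s` is `k`-dominated by `Γ` if `‖s x / N‖ ≤ k γ` on every Bohr set `B(Γ, γ)`. -/
def BohrDominated {N : ℕ} [NeZero N] (Γ : Finset (ZMod N)) (k : ℕ) (s : ZMod N) : Prop :=
  ∀ (x : ZMod N) (γ : ℝ), 0 ≤ γ → (∀ t ∈ Γ, ‖ZMod.toAddCircle (t * x)‖ ≤ γ) →
    ‖ZMod.toAddCircle (s * x)‖ ≤ k * γ

namespace BohrDominated

variable {N : ℕ} [NeZero N] {Γ Γ' : Finset (ZMod N)} {j k : ℕ} {r s : ZMod N}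

theorem mono (h : BohrDominated Γ j s) (hΓ : Γ ⊆ Γ') (hjk : j ≤ k) : BohrDominated Γ' k s := by
  intro x γ hγ hx
  refine (h x γ hγ fun t ht => hx t (hΓ ht)).trans ?_
  gcongr

theorem zero (Γ : Finset (ZMod N)) (k : ℕ) : BohrDominated Γ k 0 := by
  intro x γ hγ _
  simp only [zero_mul, map_zero, norm_zero]
  positivity

/-- Absorbing one more Riesz factor costs one new generator and one unit of the dilation constant,
so a single counter can track both. -/
theorem add_insert (h : BohrDominated Γ j s) (r : ZMod N) :
    BohrDominated (insert r Γ) (j + 1) (s + r) := by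
  intro x γ hγ hx
  have h₁ := h x γ hγ fun t ht => hx t (Finset.mem_insert_of_mem ht)
  have h₂ := hx r (Finset.mem_insert_self _ _)
  rw [add_mul, map_add]
  refine (norm_add_le _ _).trans ?_
  push_cast
  linarith

theorem sub_insert (h : BohrDominated Γ j s) (r : ZMod N) :
    BohrDominated (insert r Γ) (j + 1) (s - r) := by
  intro x γ hγ hx
  have h₁ := h x γ hγ fun t ht => hx t (Finset.mem_insert_of_mem ht)
  have h₂ := hx r (Finset.mem_insert_self _ _)
  rw [sub_mul, map_sub]
  refine (norm_sub_le _ _).trans ?_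
  push_cast
  linarith

end BohrDominated

/-! ### Riesz products and domination of the spectrum -/

section Riesz

variable {N : ℕ} [NeZero N]

theorem norm_stdAddChar (z : ZMod N) : ‖(ZMod.stdAddChar z : ℂ)‖ = 1 := by
  rw [ZMod.stdAddChar_apply, Circle.norm_coe]

theorem conj_stdAddChar (z : ZMod N) :
    conj (ZMod.stdAddChar z : ℂ) = ZMod.stdAddChar (-z) := by
  rw [AddChar.map_neg_eq_conj]

theorem sum_stdAddChar_mul (r : ZMod N) :
    ∑ y : ZMod N, (ZMod.stdAddChar (r * y) : ℂ) = if r = 0 then (N : ℂ) else 0 := by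
  have h := AddChar.sum_mulShift r (ZMod.isPrimitive_stdAddChar N)
  simp only [ZMod.card, Nat.cast_ite, Nat.cast_zero] at h
  rw [← h]
  simp_rw [mul_comm r]

theorem norm_sum_stdAddChar_mul (A : Finset (ZMod N)) (r : ZMod N) :
    ‖∑ y ∈ A, (ZMod.stdAddChar (r * y) : ℂ)‖ = ‖indicatorFourier A r‖ := by
  have h : indicatorFourier A r = conj (∑ y ∈ A, (ZMod.stdAddChar (r * y) : ℂ)) := by
    rw [indicatorFourier, ZMod.dft_apply, map_sum]
    simp_rw [conj_stdAddChar]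
    simp [mul_comm r]
  rw [h, RCLike.norm_conj]

theorem abs_re_mul_stdAddChar_le {c : ℂ} (hc : ‖c‖ ≤ 1) (z : ZMod N) :
    |(c * ZMod.stdAddChar z).re| ≤ 1 := by
  refine (Complex.abs_re_le_norm _).trans ?_
  rwa [norm_mul, norm_stdAddChar, mul_one]

/-- A Riesz factor with frequency `r` only moves Fourier mass by `0` or `±r`, so the Fourier support
of a product stays dominated. -/
theorem sum_riesz_factor (P : ZMod N → ℝ) (c : ℂ) (r s : ZMod N) :
    ∑ y, ((P y * (1 + (c * ZMod.stdAddChar (r * y)).re) : ℝ) : ℂ) * ZMod.stdAddChar (s * y) =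
      ∑ y, (P y : ℂ) * ZMod.stdAddChar (s * y) +
        c / 2 * ∑ y, (P y : ℂ) * ZMod.stdAddChar ((s + r) * y) +
        conj c / 2 * ∑ y, (P y : ℂ) * ZMod.stdAddChar ((s - r) * y) := by
  rw [Finset.mul_sum, Finset.mul_sum, ← Finset.sum_add_distrib, ← Finset.sum_add_distrib]
  refine Finset.sum_congr rfl fun y _ => ?_
  have h : (((c * ZMod.stdAddChar (r * y)).re : ℝ) : ℂ) =
      (c * ZMod.stdAddChar (r * y) + conj c * ZMod.stdAddChar (-(r * y))) / 2 := by
    rw [Complex.re_eq_add_conj, map_mul (starRingEnd ℂ), conj_stdAddChar]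
  push_cast
  rw [h, add_mul, sub_mul, sub_eq_add_neg, AddChar.map_add_eq_mul, AddChar.map_add_eq_mul]
  ring

open scoped Classical in
/-- If no small `Γ` dominates a large part of `X`, then the high moments of
`∑ r ∈ X, (1 + Re (c r * e(r y / N)))`, weighted by a nonnegative function with dominated Fourier
support, are small. -/
theorem sum_mul_pow_le_of_card_bohrDominated_le (X : Finset (ZMod N)) (c : ZMod N → ℂ)
    (hc : ∀ r, ‖c r‖ ≤ 1) {η : ℝ} (hη : 0 ≤ η) (K : ℕ)
    (hX : ∀ Γ : Finset (ZMod N), Γ.card ≤ K →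
      ((X.filter (BohrDominated Γ K)).card : ℝ) ≤ η * X.card) :
    ∀ (k j : ℕ) (Γ : Finset (ZMod N)) (P : ZMod N → ℝ), j + k ≤ K → Γ.card ≤ j → (∀ y, 0 ≤ P y) →
      (∀ r, ¬ BohrDominated Γ j r → ∑ y, (P y : ℂ) * ZMod.stdAddChar (r * y) = 0) →
      ∑ y, P y * (∑ r ∈ X, (1 + (c r * ZMod.stdAddChar (r * y)).re)) ^ k ≤
        ((1 + η) * X.card) ^ k * ∑ y, P y := by
  intro k
  induction k with
  | zero => intro j Γ P _ _ _ _; simp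
  | succ k ih =>
    intro j Γ P hjk hΓ hP hsupp
    set H : ZMod N → ℝ := fun y => ∑ r ∈ X, (1 + (c r * ZMod.stdAddChar (r * y)).re) with hH
    have hsplit : ∑ y, P y * H y ^ (k + 1) =
        ∑ r ∈ X, ∑ y, (P y * (1 + (c r * ZMod.stdAddChar (r * y)).re)) * H y ^ k := by
      rw [Finset.sum_comm]
      refine Finset.sum_congr rfl fun y _ => ?_
      rw [← Finset.sum_mul, ← Finset.mul_sum, pow_succ]
      simp only [hH]
      ring
    -- One factor of `H ^ (k + 1)` is absorbed into the weight; `r` joins `Γ`, and `j` rises by one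
    -- as `k` drops by one.
    have hstep : ∀ r ∈ X,
        ∑ y, (P y * (1 + (c r * ZMod.stdAddChar (r * y)).re)) * H y ^ k ≤
        ((1 + η) * X.card) ^ k * ∑ y, P y * (1 + (c r * ZMod.stdAddChar (r * y)).re) := by
      intro r _
      refine ih (j + 1) (insert r Γ) _ (by omega)
        ((Finset.card_insert_le _ _).trans (by omega)) ?_ ?_
      · intro y
        have := (abs_le.1 (abs_re_mul_stdAddChar_le (hc r) (r * y))).1
        exact mul_nonneg (hP y) (by linarith)
      · intro s hs
        rw [sum_riesz_factor, hsupp s, hsupp (s + r), hsupp (s - r)]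
        · simp
        · intro h
          exact hs (by simpa using h.add_insert r)
        · intro h
          exact hs (by simpa using h.sub_insert r)
        · exact fun h => hs (h.mono (Finset.subset_insert _ _) (Nat.le_succ _))
    -- The cosine term averages to zero unless `r` is dominated, in which case it is bounded
    -- trivially by `1`.
    have hone : ∀ r, ∑ y, P y * (1 + (c r * ZMod.stdAddChar (r * y)).re) ≤
        ∑ y, P y + if BohrDominated Γ K r then ∑ y, P y else 0 := by
      intro r
      simp_rw [mul_add, mul_one]
      rw [Finset.sum_add_distrib]
      gcongr
      split_ifs with hr
      · refine Finset.sum_le_sum fun y _ => ?_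
        exact mul_le_of_le_one_right (hP y)
          (abs_le.1 (abs_re_mul_stdAddChar_le (hc r) (r * y))).2
      · have h0 := hsupp r fun h => hr (h.mono subset_rfl (by omega))
        have h1 : ∑ y, P y * (c r * ZMod.stdAddChar (r * y)).re =
            (c r * ∑ y, (P y : ℂ) * ZMod.stdAddChar (r * y)).re := by
          rw [Finset.mul_sum, Complex.re_sum]
          refine Finset.sum_congr rfl fun y _ => ?_
          rw [mul_left_comm, Complex.re_ofReal_mul]
        rw [h1, h0]
        simp
    have hPs : 0 ≤ ∑ y, P y := Finset.sum_nonneg fun y _ => hP y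
    change ∑ y, P y * H y ^ (k + 1) ≤ _
    rw [hsplit]
    calc _ ≤ ∑ r ∈ X, ((1 + η) * X.card) ^ k *
          (∑ y, P y + if BohrDominated Γ K r then ∑ y, P y else 0) :=
          Finset.sum_le_sum fun r hr => (hstep r hr).trans (by gcongr; exact hone r)
      _ = ((1 + η) * X.card) ^ k *
          ((X.card + (X.filter (BohrDominated Γ K)).card) * ∑ y, P y) := by
          rw [← Finset.mul_sum, Finset.sum_add_distrib, ← Finset.sum_filter]
          simp only [Finset.sum_const, nsmul_eq_mul]
          ring
      _ ≤ ((1 + η) * X.card) ^ k * (((1 + η) * X.card) * ∑ y, P y) := by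
          gcongr
          linarith [hX Γ (by omega)]
      _ = _ := by ring

open scoped Classical in
/-- A constant multiple of `θ |X|` elements of a subset `X` of the `θ`-spectrum is dominated by a
set of size about `θ⁻¹ log (N / |A|)`. -/
theorem exists_card_bohrDominated_gt (A X : Finset (ZMod N)) {θ : ℝ} (hθ : 0 < θ)
    (hX : X ⊆ largeSpectrum A θ) (hX0 : X.Nonempty) (K : ℕ)
    (hK : (N : ℝ) * (1 + θ / 2) ^ K < A.card * (1 + θ) ^ K) :
    ∃ Γ : Finset (ZMod N), Γ.card ≤ K ∧
      θ / 2 * X.card < ((X.filter (BohrDominated Γ K)).card : ℝ) := by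
  by_contra! hcon
  have hA : 0 < (A.card : ℝ) := by
    rcases Nat.eq_zero_or_pos A.card with h | h
    · rw [h, Nat.cast_zero, zero_mul] at hK
      exact absurd hK (not_lt.2 (by positivity))
    · exact_mod_cast h
  have hXpos : 0 < (X.card : ℝ) := by exact_mod_cast hX0.card_pos
  set z : ZMod N → ℂ := fun r => ∑ y ∈ A, (ZMod.stdAddChar (r * y) : ℂ) with hz
  -- The phase that makes `c r * z r = ‖z r‖`; it is `0` when `z r = 0`, by the convention for
  -- division by zero.
  set c : ZMod N → ℂ := fun r => conj (z r) / ‖z r‖ with hcdef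
  have hc : ∀ r, ‖c r‖ ≤ 1 := by
    intro r
    simp only [hcdef, norm_div, RCLike.norm_conj, Complex.norm_real, norm_norm]
    exact div_self_le_one _
  have hcz : ∀ r, (c r * z r).re = ‖z r‖ := by
    intro r
    rcases eq_or_ne (z r) 0 with h | h
    · simp [h]
    · have h' : (‖z r‖ : ℂ) ≠ 0 := by exact_mod_cast norm_ne_zero_iff.2 h
      have : c r * z r = (‖z r‖ : ℂ) := by
        simp only [hcdef]
        rw [div_mul_eq_mul_div, Complex.conj_mul', pow_two, mul_div_assoc, div_self h', mul_one]
      rw [this, Complex.ofReal_re]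
  set H : ZMod N → ℝ := fun y => ∑ r ∈ X, (1 + (c r * ZMod.stdAddChar (r * y)).re) with hH
  have hH0 : ∀ y, 0 ≤ H y := fun y => Finset.sum_nonneg fun r _ => by
    have := (abs_le.1 (abs_re_mul_stdAddChar_le (hc r) (r * y))).1
    linarith
  have hupper : ∑ y, H y ^ K ≤ ((1 + θ / 2) * X.card) ^ K * N := by
    have := sum_mul_pow_le_of_card_bohrDominated_le X c hc (η := θ / 2) (by positivity) K hcon
      K 0 ∅ (fun _ => 1) (by omega) (by simp) (fun _ => zero_le_one) ?_
    · simpa only [one_mul, Finset.sum_const, Finset.card_univ, ZMod.card, nsmul_eq_mul, mul_one] using this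
    · intro r hr
      have hr0 : r ≠ 0 := by
        rintro rfl
        exact hr (BohrDominated.zero _ _)
      simpa [hr0] using sum_stdAddChar_mul r
  have hmean : (1 + θ) * X.card ≤ ∑ y ∈ A, (A.card : ℝ)⁻¹ * H y := by
    have h1 : ∑ y ∈ A, H y = ∑ r ∈ X, ((A.card : ℝ) + ‖z r‖) := by
      simp only [hH]
      rw [Finset.sum_comm]
      refine Finset.sum_congr rfl fun r _ => ?_
      rw [Finset.sum_add_distrib, ← Complex.re_sum, ← Finset.mul_sum, ← hcz r]
      simp [hz]
    have h2 : ∑ r ∈ X, ((A.card : ℝ) + θ * A.card) ≤ ∑ r ∈ X, ((A.card : ℝ) + ‖z r‖) := by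
      refine Finset.sum_le_sum fun r hr => ?_
      have := hX hr
      simp only [largeSpectrum, Finset.mem_filter, Finset.mem_univ, true_and] at this
      rw [← norm_sum_stdAddChar_mul] at this
      linarith
    rw [← Finset.mul_sum, h1, inv_mul_eq_div, le_div_iff₀ hA]
    refine le_trans (le_of_eq ?_) h2
    simp only [Finset.sum_const, nsmul_eq_mul]
    ring
  have hjensen : (∑ y ∈ A, (A.card : ℝ)⁻¹ * H y) ^ K ≤ ∑ y ∈ A, (A.card : ℝ)⁻¹ * H y ^ K := by
    refine Real.pow_arith_mean_le_arith_mean_pow A _ _ (fun _ _ => by positivity) ?_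
      (fun y _ => hH0 y) K
    simp [hA.ne']
  have hlower : A.card * ((1 + θ) * X.card) ^ K ≤ ∑ y, H y ^ K := by
    calc _ ≤ A.card * ∑ y ∈ A, (A.card : ℝ)⁻¹ * H y ^ K := by
          gcongr
          exact (pow_le_pow_left₀ (by positivity) hmean K).trans hjensen
      _ = ∑ y ∈ A, H y ^ K := by
          rw [← Finset.mul_sum, mul_inv_cancel_left₀ hA.ne']
      _ ≤ _ := Finset.sum_le_sum_of_subset_of_nonneg (Finset.subset_univ _)
          fun y _ _ => pow_nonneg (hH0 y) K
  have hfin := hlower.trans hupper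
  rw [mul_pow, mul_pow] at hfin
  have hXK : 0 < (X.card : ℝ) ^ K := by positivity
  have := mul_lt_mul_of_pos_right hK hXK
  linarith

open scoped Classical in
/-- Collecting dominated pieces of the `θ`-spectrum `m` times. -/
theorem exists_card_bohrDominated_ge (A : Finset (ZMod N)) {θ : ℝ} (hθ : 0 < θ)
    (K : ℕ) (hK : (N : ℝ) * (1 + θ / 2) ^ K < A.card * (1 + θ) ^ K) (m : ℕ) :
    ∃ Γ : Finset (ZMod N), Γ.card ≤ m * K ∧
      min (m * (θ * (largeSpectrum A θ).card / 4)) ((largeSpectrum A θ).card / 2) ≤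
        (((largeSpectrum A θ).filter (BohrDominated Γ K)).card : ℝ) := by
  set D := largeSpectrum A θ with hD
  induction m with
  | zero => exact ⟨∅, by simp, by simp⟩
  | succ m ih =>
    obtain ⟨Γ, hΓ, hΓD⟩ := ih
    set S := D.filter (BohrDominated Γ K) with hS
    rcases le_total ((D.card : ℝ) / 2) S.card with h | h
    · exact ⟨Γ, hΓ.trans (Nat.mul_le_mul_right _ (Nat.le_succ m)), (min_le_right _ _).trans h⟩
    rcases D.eq_empty_or_nonempty with hD0 | hD0
    · exact ⟨∅, by simp, by simp [hD0]⟩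
    have hDpos : 0 < (D.card : ℝ) := by exact_mod_cast hD0.card_pos
    have hcard : ((D \ S).card : ℝ) = D.card - S.card := by
      rw [Finset.card_sdiff_of_subset (Finset.filter_subset _ _),
        Nat.cast_sub (Finset.card_le_card (Finset.filter_subset _ _))]
    have hne : (D \ S).Nonempty := by
      rw [← Finset.card_pos]
      have : (0 : ℝ) < (D \ S).card := by rw [hcard]; linarith
      exact_mod_cast this
    obtain ⟨Γ', hΓ', hlt⟩ := exists_card_bohrDominated_gt A (D \ S) hθ Finset.sdiff_subset hne K hK
    refine ⟨Γ ∪ Γ', (Finset.card_union_le _ _).trans (by rw [Nat.succ_mul]; omega), ?_⟩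
    have hsub : S ∪ (D \ S).filter (BohrDominated Γ' K) ⊆ D.filter (BohrDominated (Γ ∪ Γ') K) := by
      intro s hs
      simp only [hS, Finset.mem_union, Finset.mem_filter, Finset.mem_sdiff] at hs ⊢
      rcases hs with hs | hs
      · exact ⟨hs.1, hs.2.mono Finset.subset_union_left le_rfl⟩
      · exact ⟨hs.1.1, hs.2.mono Finset.subset_union_right le_rfl⟩
    have hdisj : Disjoint S ((D \ S).filter (BohrDominated Γ' K)) :=
      Finset.disjoint_of_subset_right (Finset.filter_subset _ _) Finset.disjoint_sdiff
    have hle := Finset.card_le_card hsub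
    rw [Finset.card_union_of_disjoint hdisj] at hle
    have hle' : (S.card : ℝ) + ((D \ S).filter (BohrDominated Γ' K)).card ≤
        (D.filter (BohrDominated (Γ ∪ Γ') K)).card := by exact_mod_cast hle
    rw [hcard] at hlt
    -- While `S` is below half of `D`, the remainder has at least `|D|/2` elements, so each round
    -- gains at least `θ|D|/4`.
    have h1 : θ / 2 * (D.card / 2) ≤ θ / 2 * ((D.card : ℝ) - S.card) := by
      gcongr
      linarith
    rcases min_le_iff.1 hΓD with h2 | h2
    · refine (min_le_left _ _).trans ?_
      push_cast
      linarith
    · refine (min_le_right _ _).trans ?_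
      have : (0 : ℝ) ≤ ((D \ S).filter (BohrDominated Γ' K)).card := Nat.cast_nonneg _
      linarith

end Riesz

/-! ### Regular radii of Bohr sets -/

section Regularity

/-- Remove the interval with the largest left endpoint: by disjointness all the others end before it
starts, and the increments telescope. -/
theorem sum_sub_le_of_pairwiseDisjoint_Icc {ι : Type*} {G : ℝ → ℝ} (hG : Monotone G)
    (a b : ι → ℝ) {p : ℝ} (s : Finset ι) :
    ∀ q : ℝ, p ≤ q → (∀ i ∈ s, p ≤ a i ∧ a i ≤ b i ∧ b i ≤ q) →
      (s : Set ι).PairwiseDisjoint (fun i => Set.Icc (a i) (b i)) →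
      ∑ i ∈ s, (G (b i) - G (a i)) ≤ G q - G p := by
  classical
  induction s using Finset.induction_on_max_value a with
  | empty =>
    intro q hpq _ _
    simpa using hG hpq
  | insert i s hi hmax ih =>
    intro q hpq hs hdisj
    obtain ⟨h1, h2, h3⟩ := hs i (Finset.mem_insert_self _ _)
    rw [Finset.sum_insert hi]
    have := ih (a i) h1 ?_ (hdisj.subset (by simp))
    · linarith [hG h3]
    · intro x hx
      obtain ⟨g1, g2, g3⟩ := hs x (Finset.mem_insert_of_mem hx)
      refine ⟨g1, g2, ?_⟩
      by_contra! hlt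
      have hne : x ≠ i := fun h => hi (h ▸ hx)
      have hd := hdisj (by simp [hx]) (by simp) hne
      exact Set.disjoint_left.1 hd (show a i ∈ Set.Icc (a x) (b x) from ⟨hmax x hx, hlt.le⟩)
        ⟨le_rfl, h2⟩

/-- A monotone function cannot grow fast around every point of an interval. -/
theorem length_le_of_forall_exists_Icc {G : ℝ → ℝ} (hG : Monotone G) {p q p' q' L : ℝ}
    (hpq : p ≤ q) (hL : 0 < L)
    (h : ∀ x ∈ Set.Icc p' q', ∃ a b, p ≤ a ∧ b ≤ q ∧ a < b ∧ x ∈ Set.Icc a b ∧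
      L * (b - a) ≤ G b - G a) :
    L * (q' - p') ≤ 5 * (G q - G p) := by
  choose! a b ha hb hab hx hL' using h
  have hball : ∀ x, Metric.closedBall ((a x + b x) / 2) ((b x - a x) / 2) =
      Set.Icc (a x) (b x) := by
    intro x
    rw [Real.closedBall_eq_Icc]
    congr 1 <;> ring
  -- The factor `5` in the conclusion is the Vitali enlargement factor.
  obtain ⟨u, hut, hdisj, hcov⟩ := Vitali.exists_disjoint_subfamily_covering_enlargement_closedBall
    (Set.Icc p' q') (fun x => (a x + b x) / 2) (fun x => (b x - a x) / 2) ((q - p) / 2)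
    (fun x hx' => by linarith [ha x hx', hb x hx']) 5 (by norm_num)
  simp only [hball] at hdisj
  have hcount : u.Countable := hdisj.countable_of_nonempty_interior fun x hxu => by
    rw [interior_Icc]
    exact Set.nonempty_Ioo.2 (hab x (hut hxu))
  have hsub : Set.Icc p' q' ⊆
      ⋃ y ∈ u, Metric.closedBall ((a y + b y) / 2) (5 * ((b y - a y) / 2)) := by
    intro x hx'
    obtain ⟨y, hy, hxy⟩ := hcov x hx'
    rw [hball] at hxy
    exact Set.mem_biUnion hy (hxy (hx x hx'))
  have hGpq := hG hpq
  have hvol : ENNReal.ofReal (q' - p') ≤ ENNReal.ofReal (5 * ((G q - G p) / L)) := by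
    rw [← Real.volume_Icc]
    refine (MeasureTheory.measure_mono hsub).trans
      ((MeasureTheory.measure_biUnion_le _ hcount _).trans ?_)
    rw [ENNReal.tsum_eq_iSup_sum]
    refine iSup_le fun s => ?_
    simp only [Real.volume_closedBall]
    rw [← ENNReal.ofReal_sum_of_nonneg]
    · refine ENNReal.ofReal_le_ofReal ?_
      have hmem : ∀ y : u, (y : ℝ) ∈ Set.Icc p' q' := fun y => hut y.2
      have h1 : ∑ y ∈ s, (G (b y) - G (a y)) ≤ G q - G p := by
        refine sum_sub_le_of_pairwiseDisjoint_Icc hG (fun y : u => a y) (fun y : u => b y) s q hpq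
          (fun y _ => ⟨ha _ (hmem y), (hab _ (hmem y)).le, hb _ (hmem y)⟩) ?_
        intro y _ z _ hyz
        exact hdisj y.2 z.2 fun h => hyz (Subtype.ext h)
      have h2 : L * ∑ y ∈ s, (b y - a y) ≤ ∑ y ∈ s, (G (b y) - G (a y)) := by
        rw [Finset.mul_sum]
        exact Finset.sum_le_sum fun y _ => hL' _ (hmem y)
      have h3 : ∑ y ∈ s, (b y - a y) ≤ (G q - G p) / L := by
        rw [le_div_iff₀ hL, mul_comm]
        exact h2.trans h1
      calc _ = 5 * ∑ y ∈ s, (b y - a y) := by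
            rw [Finset.mul_sum]
            exact Finset.sum_congr rfl fun y _ => by ring
        _ ≤ _ := by gcongr
    · intro y _
      linarith [hab y (hut y.2)]
  rw [ENNReal.ofReal_le_ofReal_iff (by have := sub_nonneg.2 hGpq; positivity)] at hvol
  calc L * (q' - p') ≤ L * (5 * ((G q - G p) / L)) := by gcongr
    _ = _ := by field_simp

/-- If regularity failed throughout, `log F` would grow at rate at least `25d/γ₀` on an interval at
each point of `[1.02γ₀, 1.98γ₀]`. The covering lemma would then give `24d ≤ 5 · 2d`. -/
theorem exists_regular_point {F : ℝ → ℝ} (hF : Monotone F) (hpos : ∀ r, 0 < F r) {d : ℝ}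
    (hd : 1 ≤ d) {γ₀ : ℝ} (hγ₀ : 0 < γ₀) (hdouble : Real.log (F (2 * γ₀)) - Real.log (F γ₀) ≤ 2 * d) :
    ∃ γ, γ₀ ≤ γ ∧ γ ≤ 2 * γ₀ ∧ ∀ η : ℝ, 100 * d * |η| ≤ 1 →
      (1 - 100 * d * |η|) * F γ ≤ F ((1 + η) * γ) ∧
        F ((1 + η) * γ) ≤ (1 + 100 * d * |η|) * F γ := by
  by_contra! hcon
  have hG : Monotone fun r => Real.log (F r) := fun x y hxy => Real.log_le_log (hpos x) (hF hxy)
  have key := length_le_of_forall_exists_Icc hG (p := γ₀) (q := 2 * γ₀) (p' := 1.02 * γ₀)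
    (q' := 1.98 * γ₀) (L := 25 * d / γ₀) (by linarith) (by positivity) ?_
  · have h1 : 25 * d / γ₀ * (1.98 * γ₀ - 1.02 * γ₀) = 24 * d := by
      field_simp
      norm_num
    rw [h1] at key
    linarith
  intro γ hγ
  obtain ⟨hγ1, hγ2⟩ := hγ
  have hγpos : 0 < γ := by linarith
  obtain ⟨η, hη, hbad⟩ := hcon γ (by linarith) (by linarith)
  set u := 100 * d * |η| with hu
  have hu0 : 0 ≤ u := by positivity
  have hη0 : η ≠ 0 := by
    rintro rfl
    simp [hu] at hbad
  have hηabs : |η| ≤ 1 / 100 := by nlinarith [abs_nonneg η]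
  have hηpos : 0 < |η| := abs_pos.2 hη0
  -- The margin `0.02γ₀` at each end keeps `(1 + η)γ` inside `[γ₀, 2γ₀]`.
  have hlen : |η| * γ ≤ 0.0198 * γ₀ := by nlinarith
  have hgain : 25 * d / γ₀ * (|η| * γ) ≤ u / 2 := by
    rw [div_mul_eq_mul_div, div_le_iff₀ hγ₀, hu]
    nlinarith [mul_pos (show 0 < d by linarith) hηpos]
  rcases lt_or_gt_of_ne hη0 with hneg | hpos'
  · have habs : |η| = -η := abs_of_neg hneg
    have hle : F ((1 + η) * γ) ≤ (1 + u) * F γ := by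
      have : F ((1 + η) * γ) ≤ F γ := hF (by nlinarith)
      nlinarith [hpos γ]
    have hlt : F ((1 + η) * γ) < (1 - u) * F γ := by
      by_contra! h
      exact absurd (hbad h) (not_lt.2 hle)
    have hu1 : 0 < 1 - u := by
      by_contra! h
      nlinarith [hpos γ, hpos ((1 + η) * γ)]
    have hlog := Real.log_le_log (hpos _) hlt.le
    rw [Real.log_mul hu1.ne' (hpos γ).ne'] at hlog
    have h1 := Real.log_le_sub_one_of_pos hu1
    rw [habs] at hlen hgain
    refine ⟨(1 + η) * γ, γ, by linarith, by linarith, by nlinarith, ⟨by nlinarith, le_rfl⟩, ?_⟩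
    have h2 : γ - (1 + η) * γ = -η * γ := by ring
    rw [h2]
    linarith
  · have habs : |η| = η := abs_of_pos hpos'
    have hle : (1 - u) * F γ ≤ F ((1 + η) * γ) := by
      have : F γ ≤ F ((1 + η) * γ) := hF (by nlinarith)
      nlinarith [hpos γ]
    have hlog := Real.log_le_log (by have := hpos γ; positivity) (hbad hle).le
    rw [Real.log_mul (by positivity) (hpos γ).ne'] at hlog
    have h1 := Real.one_sub_inv_le_log_of_pos (show 0 < 1 + u by linarith)
    have h3 : u / 2 ≤ 1 - (1 + u)⁻¹ := by
      have : 1 - (1 + u)⁻¹ = u / (1 + u) := by field_simp; ring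
      rw [this]
      gcongr
      linarith
    rw [habs] at hlen hgain
    refine ⟨γ, (1 + η) * γ, by linarith, by linarith, by nlinarith, ⟨le_rfl, by nlinarith⟩, ?_⟩
    have h2 : (1 + η) * γ - γ = η * γ := by ring
    rw [h2]
    linarith

theorem UnitAddCircle.exists_coe_eq_abs_eq_norm (z : UnitAddCircle) :
    ∃ w : ℝ, (w : UnitAddCircle) = z ∧ |w| = ‖z‖ := by
  induction z using QuotientAddGroup.induction_on with
  | H x =>
    refine ⟨x - round x, ?_, ?_⟩
    · have : ((round x : ℝ) : UnitAddCircle) = 0 := by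
        rw [AddCircle.coe_eq_zero_iff]
        exact ⟨round x, by simp⟩
      rw [AddCircle.coe_sub, this, sub_zero]
    · exact UnitAddCircle.norm_eq.symm

variable {N : ℕ} [NeZero N]

theorem mem_bohrSet {Γ : Finset (ZMod N)} {γ : ℝ} {x : ZMod N} :
    x ∈ bohrSet Γ γ ↔ ∀ t ∈ Γ, ‖ZMod.toAddCircle (t * x)‖ ≤ γ := by
  simp [bohrSet]

/-- Pigeonhole into cells of side `γ`: each frequency has real representatives in `[-2γ, 2γ]`, hence
floors in `{-2, …, 2}`. Two points of one cell differ by an element of `bohrSet Γ γ`. -/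
theorem card_bohrSet_two_mul_le (Γ : Finset (ZMod N)) {γ : ℝ} (hγ : 0 < γ) :
    (bohrSet Γ (2 * γ)).card ≤ 5 ^ Γ.card * (bohrSet Γ γ).card := by
  classical
  choose w hw hwn using UnitAddCircle.exists_coe_eq_abs_eq_norm
  set f : ZMod N → (Γ → ℤ) := fun x t => ⌊w (ZMod.toAddCircle ((t : ZMod N) * x)) / γ⌋ with hf
  have himage : (bohrSet Γ (2 * γ)).image f ⊆ Fintype.piFinset fun _ : Γ => Finset.Icc (-2 : ℤ) 2 := by
    intro g hg
    obtain ⟨x, hx, rfl⟩ := Finset.mem_image.1 hg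
    rw [Fintype.mem_piFinset]
    intro t
    have h := mem_bohrSet.1 hx t t.2
    rw [← hwn, abs_le] at h
    rw [Finset.mem_Icc]
    constructor
    · rw [Int.le_floor, le_div_iff₀ hγ]
      push_cast
      linarith [h.1]
    · refine Int.floor_le_iff.2 ?_
      rw [div_lt_iff₀ hγ]
      push_cast
      linarith [h.2]
  have hcard : ((bohrSet Γ (2 * γ)).image f).card ≤ 5 ^ Γ.card := by
    refine (Finset.card_le_card himage).trans (le_of_eq ?_)
    simp
  have hfiber : ∀ g ∈ (bohrSet Γ (2 * γ)).image f,
      ((bohrSet Γ (2 * γ)).filter fun x => f x = g).card ≤ (bohrSet Γ γ).card := by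
    intro g hg
    obtain ⟨x₀, _, rfl⟩ := Finset.mem_image.1 hg
    refine Finset.card_le_card_of_injOn (fun x => x - x₀) ?_ fun x _ y _ h => sub_left_injective h
    intro x hx
    have hfx := (Finset.mem_filter.1 hx).2
    refine mem_bohrSet.2 fun t ht => ?_
    have h1 : ⌊w (ZMod.toAddCircle (t * x)) / γ⌋ = ⌊w (ZMod.toAddCircle (t * x₀)) / γ⌋ :=
      congrFun hfx ⟨t, ht⟩
    have h2 := Int.abs_sub_lt_one_of_floor_eq_floor h1
    rw [← sub_div, abs_div, abs_of_pos hγ, div_lt_one hγ] at h2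
    rw [mul_sub, map_sub, ← hw (ZMod.toAddCircle (t * x)), ← hw (ZMod.toAddCircle (t * x₀)),
      ← AddCircle.coe_sub]
    refine le_trans ?_ h2.le
    rw [UnitAddCircle.norm_eq]
    simpa using round_le (w (ZMod.toAddCircle (t * x)) - w (ZMod.toAddCircle (t * x₀))) 0
  calc _ ≤ (bohrSet Γ γ).card * ((bohrSet Γ (2 * γ)).image f).card :=
        Finset.card_le_mul_card_image _ _ hfiber
    _ ≤ (bohrSet Γ γ).card * 5 ^ Γ.card := by gcongr
    _ = _ := mul_comm _ _

theorem bohrSet_mono (Γ : Finset (ZMod N)) : Monotone (bohrSet Γ) :=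
  fun _ _ h _ hx => mem_bohrSet.2 fun t ht => (mem_bohrSet.1 hx t ht).trans h

theorem zero_mem_bohrSet (Γ : Finset (ZMod N)) {γ : ℝ} (hγ : 0 ≤ γ) : 0 ∈ bohrSet Γ γ :=
  mem_bohrSet.2 fun t _ => by simpa using hγ

theorem card_bohrSet_pos (Γ : Finset (ZMod N)) {γ : ℝ} (hγ : 0 ≤ γ) : 0 < (bohrSet Γ γ).card :=
  Finset.card_pos.2 ⟨0, zero_mem_bohrSet Γ hγ⟩

/-- Bohr sets of arbitrary rank are regular at some radius within a factor `2` of a given one. -/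
theorem exists_isRegularBohr (Γ : Finset (ZMod N)) {γ₀ : ℝ} (hγ₀ : 0 < γ₀) :
    ∃ γ, γ₀ ≤ γ ∧ γ ≤ 2 * γ₀ ∧ IsRegularBohr Γ γ := by
  rcases Γ.eq_empty_or_nonempty with rfl | hΓ
  · exact ⟨γ₀, le_rfl, by linarith, fun η _ => by simp [bohrSet]⟩
  have hd : (1 : ℝ) ≤ Γ.card := by exact_mod_cast hΓ.card_pos
  -- Truncating at `0` keeps `F` positive at negative radii, so its logarithm is monotone on all of
  -- `ℝ`.
  set F : ℝ → ℝ := fun r => (bohrSet Γ (max r 0)).card with hF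
  have hFpos : ∀ r, 0 < F r := fun r => by
    simp only [hF]
    exact_mod_cast card_bohrSet_pos Γ (le_max_right r 0)
  have hFmono : Monotone F := fun x y hxy => by
    simp only [hF]
    exact_mod_cast Finset.card_le_card (bohrSet_mono Γ (max_le_max_right 0 hxy))
  have hFeq : ∀ r, 0 ≤ r → F r = (bohrSet Γ r).card := fun r hr => by simp only [hF, max_eq_left hr]
  have hdouble : Real.log (F (2 * γ₀)) - Real.log (F γ₀) ≤ 2 * Γ.card := by
    rw [sub_le_iff_le_add, ← Real.log_exp (2 * (Γ.card : ℝ)),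
      ← Real.log_mul (Real.exp_pos _).ne' (hFpos _).ne']
    refine Real.log_le_log (hFpos _) ?_
    rw [hFeq _ hγ₀.le, hFeq _ (by linarith)]
    have h5 : (5 : ℝ) ≤ Real.exp 2 := by
      have : Real.exp 2 = Real.exp 1 * Real.exp 1 := by rw [← Real.exp_add]; norm_num
      nlinarith [Real.exp_one_gt_d9]
    have h6 : (5 : ℝ) ^ Γ.card ≤ Real.exp (2 * (Γ.card : ℝ)) := by
      rw [mul_comm, Real.exp_nat_mul]
      gcongr
    have h7 : ((bohrSet Γ (2 * γ₀)).card : ℝ) ≤ 5 ^ Γ.card * (bohrSet Γ γ₀).card := by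
      exact_mod_cast card_bohrSet_two_mul_le Γ hγ₀
    exact h7.trans (by gcongr)
  obtain ⟨γ, h1, h2, h3⟩ := exists_regular_point hFmono hFpos hd hγ₀ hdouble
  refine ⟨γ, h1, h2, fun η hη => ?_⟩
  have hη' : |η| ≤ 1 := by nlinarith [abs_nonneg η]
  have h4 := h3 η hη
  have hγ : 0 ≤ γ := by linarith
  rwa [hFeq γ hγ, hFeq _ (mul_nonneg (by linarith [(abs_le.1 hη').1]) hγ)] at h4

end Regularity

/-! ### Density increment on a translate of a Bohr set -/

section Increment

theorem card_image_add_inter {N : ℕ} (A B : Finset (ZMod N)) (t : ZMod N) :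
    (((A.image fun a => a + t) ∩ B).card : ℝ) = ∑ a ∈ A, if a + t ∈ B then (1 : ℝ) else 0 := by
  rw [Finset.sum_boole, ← Finset.filter_mem_eq_inter, Finset.filter_image,
    Finset.card_image_of_injective _ (add_left_injective t)]

variable {N : ℕ} [NeZero N]

theorem one_half_le_re_stdAddChar {z : ZMod N} (hz : ‖ZMod.toAddCircle z‖ ≤ 1 / 6) :
    1 / 2 ≤ (ZMod.stdAddChar z : ℂ).re := by
  obtain ⟨w, hw, hwn⟩ := UnitAddCircle.exists_coe_eq_abs_eq_norm (ZMod.toAddCircle z)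
  rw [← hwn] at hz
  have h1 : (ZMod.stdAddChar z : ℂ) = Circle.exp (2 * Real.pi * w) := by
    rw [ZMod.stdAddChar_apply]
    change ((ZMod.toAddCircle z).toCircle : ℂ) = _
    rw [← hw, AddCircle.toCircle_apply_mk, div_one]
  rw [h1, Circle.coe_exp, Complex.exp_ofReal_mul_I_re, ← Real.cos_abs, ← Real.cos_pi_div_three]
  have h2 : |2 * Real.pi * w| = 2 * Real.pi * |w| := by
    rw [abs_mul, abs_of_pos Real.two_pi_pos]
  rw [h2]
  refine Real.cos_le_cos_of_nonneg_of_le_pi (by positivity) (by linarith [Real.pi_pos]) ?_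
  nlinarith [Real.pi_pos]

theorem sum_norm_sq_sum_stdAddChar (f : ZMod N → ℝ) :
    ∑ r, ‖∑ t, (f t : ℂ) * ZMod.stdAddChar (r * t)‖ ^ 2 = N * ∑ t, f t ^ 2 := by
  have h : ((∑ r, ‖∑ t, (f t : ℂ) * ZMod.stdAddChar (r * t)‖ ^ 2 : ℝ) : ℂ) =
      ((N * ∑ t, f t ^ 2 : ℝ) : ℂ) := by
    push_cast
    simp_rw [← Complex.mul_conj', map_sum, map_mul, Complex.conj_ofReal, conj_stdAddChar,
      Finset.sum_mul_sum]
    rw [Finset.sum_comm, Finset.mul_sum]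
    refine Finset.sum_congr rfl fun t _ => ?_
    rw [Finset.sum_comm]
    have h1 : ∀ t', ∑ r : ZMod N, (f t : ℂ) * ZMod.stdAddChar (r * t) *
        (f t' * ZMod.stdAddChar (-(r * t'))) = f t * f t' * if t = t' then (N : ℂ) else 0 := by
      intro t'
      simp_rw [← sub_eq_zero (a := t), ← sum_stdAddChar_mul, Finset.mul_sum]
      refine Finset.sum_congr rfl fun r _ => ?_
      rw [sub_mul, sub_eq_add_neg, AddChar.map_add_eq_mul, mul_comm t r, mul_comm t' r]
      ring
    simp_rw [h1]
    simp
    ring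
  exact_mod_cast h

theorem sum_card_image_add_inter_mul (A B : Finset (ZMod N)) (r : ZMod N) :
    ∑ t, ((((A.image fun a => a + t) ∩ B).card : ℝ) : ℂ) * ZMod.stdAddChar (r * t) =
      conj (∑ a ∈ A, (ZMod.stdAddChar (r * a) : ℂ)) * ∑ b ∈ B, ZMod.stdAddChar (r * b) := by
  simp_rw [card_image_add_inter, map_sum, conj_stdAddChar, Finset.sum_mul]
  simp_rw [Complex.ofReal_sum, apply_ite Complex.ofReal, Complex.ofReal_one, Complex.ofReal_zero,
    Finset.sum_mul]
  rw [Finset.sum_comm]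
  refine Finset.sum_congr rfl fun a _ => ?_
  rw [← Equiv.sum_comp (Equiv.subRight a), Finset.mul_sum]
  simp only [Equiv.subRight_apply, add_sub_cancel, ite_mul, one_mul, zero_mul]
  rw [← Finset.sum_filter, Finset.filter_univ_mem]
  refine Finset.sum_congr rfl fun b _ => ?_
  rw [← AddChar.map_add_eq_mul]
  congr 1
  ring

/-- If all characters in a subset `D` of the `θ`-spectrum of `A` are close to `1` on `B`, then `A`
has large density on a translate of `B`. -/
theorem exists_card_image_add_inter_ge (A B D : Finset (ZMod N)) {θ : ℝ} (hθ : 0 ≤ θ)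
    (hD : D ⊆ largeSpectrum A θ)
    (hB : ∀ r ∈ D, ∀ x ∈ B, 1 / 2 ≤ (ZMod.stdAddChar (r * x) : ℂ).re) :
    ∃ t, D.card * θ ^ 2 / 4 * A.card * B.card ≤
      N * (((A.image fun a => a + t) ∩ B).card : ℝ) := by
  set f : ZMod N → ℝ := fun t => (((A.image fun a => a + t) ∩ B).card : ℝ) with hf
  obtain ⟨t, -, ht⟩ := Finset.exists_max_image Finset.univ f Finset.univ_nonempty
  refine ⟨t, ?_⟩
  have hf0 : ∀ t, 0 ≤ f t := fun t => Nat.cast_nonneg _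
  have hsum : ∑ t, f t = A.card * B.card := by
    have h := sum_card_image_add_inter_mul A B 0
    simp only [zero_mul, AddChar.map_zero_eq_one, mul_one, Finset.sum_const, nsmul_eq_mul,
      map_natCast] at h
    simp only [hf]
    exact_mod_cast h
  have hlow : ∀ r ∈ D, (θ * A.card * (B.card / 2)) ^ 2 ≤
      ‖∑ t, (f t : ℂ) * ZMod.stdAddChar (r * t)‖ ^ 2 := by
    intro r hr
    refine pow_le_pow_left₀ (by positivity) ?_ 2
    simp only [hf]
    rw [sum_card_image_add_inter_mul, norm_mul, RCLike.norm_conj, norm_sum_stdAddChar_mul]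
    have h1 : θ * A.card ≤ ‖indicatorFourier A r‖ := by
      have := hD hr
      simpa [largeSpectrum] using this
    have h2 : (B.card : ℝ) / 2 ≤ ‖∑ b ∈ B, (ZMod.stdAddChar (r * b) : ℂ)‖ := by
      refine le_trans ?_ (Complex.re_le_norm _)
      rw [Complex.re_sum]
      calc (B.card : ℝ) / 2 = ∑ b ∈ B, (1 / 2 : ℝ) := by
            rw [Finset.sum_const, nsmul_eq_mul]; ring
        _ ≤ _ := Finset.sum_le_sum fun b hb => hB r hr b hb
    gcongr
  have hL2 : D.card * (θ * A.card * (B.card / 2)) ^ 2 ≤ N * (f t * (A.card * B.card)) := by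
    calc D.card * (θ * A.card * (B.card / 2)) ^ 2
        = ∑ r ∈ D, (θ * A.card * (B.card / 2)) ^ 2 := by rw [Finset.sum_const, nsmul_eq_mul]
      _ ≤ ∑ r ∈ D, ‖∑ t, (f t : ℂ) * ZMod.stdAddChar (r * t)‖ ^ 2 := Finset.sum_le_sum hlow
      _ ≤ ∑ r, ‖∑ t, (f t : ℂ) * ZMod.stdAddChar (r * t)‖ ^ 2 :=
          Finset.sum_le_sum_of_subset_of_nonneg (Finset.subset_univ _) fun _ _ _ => by positivity
      _ = N * ∑ s, f s ^ 2 := sum_norm_sq_sum_stdAddChar f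
      -- One factor of `f` is replaced by its maximum; the other sums to `|A||B|`.
      _ ≤ N * ∑ s, f t * f s := by
          gcongr with s _
          rw [pow_two]
          exact mul_le_mul_of_nonneg_right (ht s (Finset.mem_univ _)) (hf0 s)
      _ = _ := by rw [← Finset.mul_sum, hsum]
  rcases (show (0 : ℝ) ≤ A.card * B.card by positivity).eq_or_lt with h | h
  · rw [mul_assoc, ← h, mul_zero]
    have := hf0 t
    positivity
  · refine le_of_mul_le_mul_right ?_ h
    calc _ = D.card * (θ * A.card * (B.card / 2)) ^ 2 := by ring
      _ ≤ _ := hL2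
      _ = _ := by ring

end Increment

/-! ### Numerical inequalities for the parameters -/

section Parameters

/-- For `θ ≤ 1`, `(1 + θ) / (1 + θ/2) ≥ exp (θ/4)`, so the `K`-th power of this ratio exceeds `exp
L` once `θK > 4L`. -/
theorem one_add_half_pow_lt {N a L θ : ℝ} (hθ : 0 ≤ θ) (hθ1 : θ ≤ 1) (ha : 0 < a)
    (hN : N ≤ a * Real.exp L) {K : ℕ} (hK : 4 * L < θ * K) :
    N * (1 + θ / 2) ^ K < a * (1 + θ) ^ K := by
  have h1 : (1 + θ / 2) * Real.exp (θ / 4) ≤ 1 + θ := by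
    have h := Real.one_sub_le_exp_neg (θ / 4)
    rw [Real.exp_neg] at h
    have hpos : 0 < 1 - θ / 4 := by linarith
    have h2 : Real.exp (θ / 4) ≤ (1 - θ / 4)⁻¹ := by
      rwa [le_inv_comm₀ (Real.exp_pos _) hpos]
    calc (1 + θ / 2) * Real.exp (θ / 4) ≤ (1 + θ / 2) * (1 - θ / 4)⁻¹ := by gcongr
      _ ≤ 1 + θ := by
        rw [← div_eq_mul_inv, div_le_iff₀ hpos]
        nlinarith
  have h3 : Real.exp L < Real.exp (θ / 4) ^ K := by
    rw [← Real.exp_nat_mul]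
    exact Real.exp_lt_exp.2 (by linarith)
  calc N * (1 + θ / 2) ^ K ≤ a * Real.exp L * (1 + θ / 2) ^ K := by gcongr
    _ < a * Real.exp (θ / 4) ^ K * (1 + θ / 2) ^ K := by gcongr
    _ = a * ((1 + θ / 2) * Real.exp (θ / 4)) ^ K := by rw [mul_pow]; ring
    _ ≤ _ := by gcongr

theorem mul_rpow_le_min_mul_sq {c μ δ θ S m : ℝ} (hc : 0 < c) (hμ1 : μ ≤ 1 / 5)
    (hδ : 0 < δ) (hδ1 : δ ≤ 1) (hθ : 0 < θ) (hθδ : θ ≤ δ ^ ((1 : ℝ) / 10))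
    (hS : c * (θ ^ (-3 : ℝ) * δ ^ (μ / 4)) ≤ S) (hm : δ ^ (-(μ / 2)) ≤ m) :
    c / 4 * δ ^ (-(μ / 4)) ≤ min (m * (θ * S / 4)) (S / 2) * θ ^ 2 := by
  have h3 : θ ^ (-3 : ℝ) * θ ^ 3 = 1 := by
    rw [← Real.rpow_natCast, ← Real.rpow_add hθ]
    norm_num
  have hS3 : c * δ ^ (μ / 4) ≤ S * θ ^ 3 := by
    calc c * δ ^ (μ / 4) = c * (θ ^ (-3 : ℝ) * δ ^ (μ / 4)) * θ ^ 3 := by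
          rw [show c * (θ ^ (-3 : ℝ) * δ ^ (μ / 4)) * θ ^ 3 =
            c * δ ^ (μ / 4) * (θ ^ (-3 : ℝ) * θ ^ 3) by ring, h3, mul_one]
      _ ≤ _ := by gcongr
  have hsplit : δ ^ (-(μ / 4)) = δ ^ (-(μ / 2)) * δ ^ (μ / 4) := by
    rw [← Real.rpow_add hδ]
    ring_nf
  have hm0 : 0 ≤ m := le_trans (by positivity) hm
  have hnn : 0 ≤ S * θ ^ 3 := le_trans (by positivity) hS3
  rw [hsplit, min_mul_of_nonneg _ _ (by positivity), le_min_iff]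
  constructor
  · calc c / 4 * (δ ^ (-(μ / 2)) * δ ^ (μ / 4)) = δ ^ (-(μ / 2)) * (c * δ ^ (μ / 4)) / 4 := by ring
      _ ≤ m * (S * θ ^ 3) / 4 := by gcongr
      _ = _ := by ring
  · have hθ' : δ ^ (-(μ / 2)) * θ ≤ 1 := by
      calc δ ^ (-(μ / 2)) * θ ≤ δ ^ (-(μ / 2)) * δ ^ ((1 : ℝ) / 10) := by gcongr
        _ = δ ^ (-(μ / 2) + 1 / 10) := by rw [Real.rpow_add hδ]
        _ ≤ 1 := Real.rpow_le_one hδ.le hδ1 (by linarith)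
    have hS0 : 0 ≤ S := le_trans (by positivity) hS
    calc c / 4 * (δ ^ (-(μ / 2)) * δ ^ (μ / 4)) = δ ^ (-(μ / 2)) * (c * δ ^ (μ / 4)) / 4 := by ring
      _ ≤ δ ^ (-(μ / 2)) * (S * θ ^ 3) / 4 := by gcongr
      _ = (δ ^ (-(μ / 2)) * θ) * (S * θ ^ 2 / 4) := by ring
      _ ≤ 1 * (S * θ ^ 2 / 4) := by gcongr
      _ ≤ S / 2 * θ ^ 2 := by nlinarith [mul_nonneg hS0 (sq_nonneg θ)]

end Parameters
end

/-! ### Choice of parameters and conclusion -/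

theorem lemmal :
    ∃ μ₀ : ℝ, 0 < μ₀ ∧ ∀ c : ℝ, 0 < c →
      ∃ C c₁ c₂ : ℝ, 0 < C ∧ 0 < c₁ ∧ 0 < c₂ ∧
        ∀ μ : ℝ, 0 < μ → μ ≤ μ₀ →
        ∀ (N : ℕ) [NeZero N] (A : Finset (ZMod N)) (δ θ : ℝ),
          A.Nonempty →
          δ = (A.card : ℝ) / (N : ℝ) →
          δ ^ (μ / 20) * Real.log (1 / δ) < 1 →
          δ ^ (1 - μ) ≤ θ →
          θ ≤ δ ^ ((1 : ℝ) / 10) →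
          c * (θ ^ (-3 : ℝ) * δ ^ (μ / 4)) ≤ ((largeSpectrum A θ).card : ℝ) →
          ∃ (Γ : Finset (ZMod N)) (γ : ℝ),
            0 < γ ∧ γ ≤ 1 / 2 ∧
            IsRegularBohr Γ γ ∧
            (Γ.card : ℝ) ≤ C * δ ^ (-1 + μ / 3) ∧
            c₁ * δ ^ (1 - μ / 3) ≤ γ ∧
            ∃ t : ZMod N,
              c₂ * δ ^ (1 - μ / 4) * ((bohrSet Γ γ).card : ℝ)
                ≤ ((A.image (fun a => a + t) ∩ bohrSet Γ γ).card : ℝ) := by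

  classical
  -- `10 = 2 · 5` from the bounds on `m` and `K`; `1/60 = 1/(12 · 5)` from the radius `1/(12K)`;
  -- `c/16` combines `c/4` from the size of `D` with the `1/4` of the increment.
  refine ⟨1 / 5, by norm_num, fun c hc => ⟨10, 1 / 60, c / 16, by norm_num, by norm_num,
    by positivity, ?_⟩⟩
  intro μ hμ hμ1 N _ A δ θ hA hδeq hlog hθlow hθup hS
  have hNpos : (0 : ℝ) < N := by exact_mod_cast Nat.pos_of_neZero N
  have hApos : (0 : ℝ) < A.card := by exact_mod_cast hA.card_pos
  have hδ : 0 < δ := by rw [hδeq]; positivity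
  have hAN : (A.card : ℝ) = δ * N := by rw [hδeq, div_mul_cancel₀ _ hNpos.ne']
  have hδ1 : δ ≤ 1 := by
    rw [hδeq, div_le_one hNpos]
    exact_mod_cast (Finset.card_le_univ A).trans (ZMod.card N).le
  have hθ : 0 < θ := lt_of_lt_of_le (by positivity) hθlow
  have hθ1 : θ ≤ 1 := hθup.trans (Real.rpow_le_one hδ.le hδ1 (by norm_num))
  set L := Real.log (1 / δ) with hL
  have hL0 : 0 ≤ L := Real.log_nonneg (by rwa [le_div_iff₀ hδ, one_mul])
  have hexpL : Real.exp L = 1 / δ := Real.exp_log (by positivity)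
  -- The `+ 1` makes `4L < θK` strict and keeps `K` positive even when `L = 0`.
  set K : ℕ := ⌊4 * L / θ⌋₊ + 1 with hKdef
  have hKlow : 4 * L < θ * K := by
    have h := Nat.lt_floor_add_one (4 * L / θ)
    rw [div_lt_iff₀ hθ] at h
    rw [hKdef]
    push_cast
    linarith
  have hK1 : (1 : ℝ) ≤ K := by
    rw [hKdef]
    push_cast
    linarith [Nat.cast_nonneg (α := ℝ) ⌊4 * L / θ⌋₊]
  have hLup : L ≤ δ ^ (-(μ / 20)) := by
    rw [Real.rpow_neg hδ.le, ← one_div, le_div_iff₀ (by positivity), mul_comm]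
    exact hlog.le
  have hθinv : 1 / θ ≤ δ ^ (-(1 - μ)) := by
    rw [Real.rpow_neg hδ.le, ← one_div]
    gcongr
  have hone : ∀ e : ℝ, e ≤ 0 → 1 ≤ δ ^ e := fun e he =>
    Real.one_le_rpow_of_pos_of_le_one_of_nonpos hδ hδ1 he
  have hKup : (K : ℝ) ≤ 5 * δ ^ (-(μ / 20) + -(1 - μ)) := by
    have h1 : (⌊4 * L / θ⌋₊ : ℝ) ≤ 4 * L / θ := Nat.floor_le (by positivity)
    have h2 : 4 * L / θ ≤ 4 * (δ ^ (-(μ / 20)) * δ ^ (-(1 - μ))) := by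
      rw [mul_div_assoc, div_eq_mul_one_div]
      gcongr
    have h3 := hone (-(μ / 20) + -(1 - μ)) (by linarith)
    rw [← Real.rpow_add hδ] at h2
    rw [hKdef]
    push_cast
    linarith
  set m : ℕ := ⌈δ ^ (-(μ / 2))⌉₊ with hmdef
  have hmlow : δ ^ (-(μ / 2)) ≤ m := Nat.le_ceil _
  have hmup : (m : ℝ) ≤ 2 * δ ^ (-(μ / 2)) := by
    have h1 := (Nat.ceil_lt_add_one (show 0 ≤ δ ^ (-(μ / 2)) by positivity)).le
    linarith [hone (-(μ / 2)) (by linarith)]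
  obtain ⟨Γ, hΓ, hΓD⟩ := exists_card_bohrDominated_ge A hθ K
    (one_add_half_pow_lt hθ.le hθ1 hApos
      (by rw [hexpL, hAN]; exact (by field_simp : (N : ℝ) = _).le) hKlow) m
  set D := (largeSpectrum A θ).filter (BohrDominated Γ K) with hD
  -- Regularisation may double the radius, so starting at `1/(12K)` ensures `Kγ ≤ 1/6`, and `cos
  -- (2π/6) = 1/2`.
  obtain ⟨γ, hγlow, hγup, hreg⟩ := exists_isRegularBohr Γ (γ₀ := 1 / (12 * K)) (by positivity)
  have hγpos : 0 < γ := lt_of_lt_of_le (by positivity) hγlow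
  have hKγ : K * γ ≤ 1 / 6 := by
    calc K * γ ≤ K * (2 * (1 / (12 * K))) := by gcongr
      _ = 1 / 6 := by field_simp; norm_num
  obtain ⟨t, ht⟩ := exists_card_image_add_inter_ge A (bohrSet Γ γ) D hθ.le
    (Finset.filter_subset _ _) fun r hr x hx => one_half_le_re_stdAddChar
      (((Finset.mem_filter.1 hr).2 x γ hγpos.le (mem_bohrSet.1 hx)).trans hKγ)
  have hKup' : (K : ℝ) ≤ 5 * δ ^ (-1 + μ / 3) := by
    refine hKup.trans ?_
    gcongr 5 * ?_
    exact Real.rpow_le_rpow_of_exponent_ge hδ hδ1 (by linarith)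
  refine ⟨Γ, γ, hγpos, by nlinarith, hreg, ?_, ?_, t, ?_⟩
  · calc (Γ.card : ℝ) ≤ m * K := by exact_mod_cast hΓ
      _ ≤ 2 * δ ^ (-(μ / 2)) * (5 * δ ^ (-(μ / 20) + -(1 - μ))) := by gcongr
      _ = 10 * δ ^ (-(μ / 2) + (-(μ / 20) + -(1 - μ))) := by rw [Real.rpow_add hδ (-(μ / 2))]; ring
      -- The exponent on the left is `-1 + 9μ/20`, and `9/20 > 1/3`.
      _ ≤ 10 * δ ^ (-1 + μ / 3) := by
        gcongr 10 * ?_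
        exact Real.rpow_le_rpow_of_exponent_ge hδ hδ1 (by linarith)
  · refine le_trans ?_ hγlow
    rw [show 1 - μ / 3 = -(-1 + μ / 3) by ring, Real.rpow_neg hδ.le, ← one_div, div_mul_div_comm,
      one_mul]
    refine one_div_le_one_div_of_le (by positivity) ?_
    linarith
  · have hgain := (mul_rpow_le_min_mul_sq hc hμ1 hδ hδ1 hθ hθup hS hmlow).trans
      (mul_le_mul_of_nonneg_right hΓD (sq_nonneg θ))
    have hpow : δ ^ (1 - μ / 4) = δ * δ ^ (-(μ / 4)) := by
      rw [sub_eq_add_neg, Real.rpow_add hδ, Real.rpow_one]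
    refine le_of_mul_le_mul_left (le_trans ?_ ht) hNpos
    rw [hpow, hAN]
    calc N * (c / 16 * (δ * δ ^ (-(μ / 4))) * ((bohrSet Γ γ).card : ℝ))
        = c / 4 * δ ^ (-(μ / 4)) / 4 * (δ * N) * (bohrSet Γ γ).card := by ring
      _ ≤ D.card * θ ^ 2 / 4 * (δ * N) * (bohrSet Γ γ).card :=
        mul_le_mul_of_nonneg_right (mul_le_mul_of_nonneg_right
          (div_le_div_of_nonneg_right hgain zero_le_four) (by positivity)) (Nat.cast_nonneg _)
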